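/- A represented space is a set $X$ with a partial surjection $\delta_X:\subseteq\mathbb{N}^{\mathbb{N}}\to X$; $p$ is a name of $x$ if $\delta_X(p)=x$. Sierpiński space $\Sigma=\{\bot,\top\}$ is represented so that $0^\omega$ is the only name of $\bot$. A set $U\subseteq X$ is open if its characteristic function $X\to\Sigma$ has a continuous realizer; $\mathcal{O}(X)$ is the space of open sets, represented as a function space (a name of $U$ encodes a continuous realizer of its characteristic function). A set is closed if its complement is open. $\mathcal{A}(X)$ is the space of closed sets $A\subseteq X$, where a name of $A$ is a name of $X\setminus A\in\mathcal{O}(X)$. $\mathcal{V}(X)$ is the space of closed sets $A\subseteq X$, where a name of $A$ is a name of $\{U\in\mathcal{O}(X) : U\cap A\neq\emptyset\}\in\mathcal{O}(\mathcal{O}(X))$. Closed choice $\mathrm{C}_X:\subseteq\mathcal{A}(X)\rightrightarrows X$ and overt choice $\mathrm{VC}_X:\subseteq\mathcal{V}(X)\rightrightarrows X$ are the problems of finding, given a nonempty closed set $A$, some $x\in A$. Here $\mathbb{N}$ carries its standard representation, and $\mathbb{Q}$ is a subspace of $\mathbb{R}$ with its Cauchy representation. For multivalued functions $f,g$ between represented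 spaces, $f\leq_{\mathrm{W}}g$ means that there are computable $H,K:\subseteq\mathbb{N}^{\mathbb{N}}\to\mathbb{N}^{\mathbb{N}}$ such that $p\mapsto K\langle p,G(H(p))\rangle$ is a realizer of $f$ whenever $G$ is a realizer of $g$; $f\equiv_{\mathrm{W}}g$ means $f\leq_{\mathrm{W}}g$ and $g\leq_{\mathrm{W}}f$. Corollary. Overt choice on the rationals is Weihrauch incomparable with $\mathrm{C}_{\mathbb{N}}$, that is, $\mathrm{VC}_{\mathbb{Q}}\not\leq_{\mathrm{W}}\mathrm{C}_{\mathbb{N}}$ and $\mathrm{C}_{\mathbb{N}}\not\leq_{\mathrm{W}}\mathrm{VC}_{\mathbb{Q}}$; moreover $\mathrm{C}_{\mathbb{N}}\equiv_{\mathrm{W}}\mathrm{C}_{\mathbb{Q}}$. -/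

import Mathlib

namespace OvertChoice

/-- Baire space: names are infinite sequences of natural numbers. -/
abbrev Baire : Type := ℕ → ℕ

/-- The finite word `p 0, …, p (k - 1)`. -/
def prefixOf (p : Baire) (k : ℕ) : List ℕ := (List.range k).map p

/-- `Applies α p q`: the partial continuous function on Baire space coded by the associate `α`
(the application of Kleene's second algebra) is defined at `p` with value `q`.
The answer to the query "what is the `n`-th output symbol, given the input prefix `w`?" is
`α (n, w)`, where `0` means "read more input" and `v + 1` means "the symbol is `v`"; the first
positive answer along the prefixes of `p` counts. -/
def Applies (α p q : Baire) : Prop :=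
  ∀ n, ∃ k, α (Nat.pair n (Encodable.encode (prefixOf p k))) = q n + 1 ∧
    ∀ j < k, α (Nat.pair n (Encodable.encode (prefixOf p j))) = 0

theorem Applies.unique {α p q q' : Baire} (h : Applies α p q) (h' : Applies α p q') :
    q = q' := by
  funext n
  obtain ⟨k, hk, hk0⟩ := h n
  obtain ⟨k', hk', hk0'⟩ := h' n
  have : k = k' := by
    rcases lt_trichotomy k k' with hlt | heq | hlt
    · have := hk0' k hlt; omega
    · exact heq
    · have := hk0 k' hlt; omega
  subst this
  omega

/-- A partial function on Baire space is computable if some computable associate computes it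
(on its domain). -/
def ComputableOp (F : Baire →. Baire) : Prop :=
  ∃ α : Baire, Computable α ∧ ∀ p q, q ∈ F p → Applies α p q

/-- A represented space: a set with a partial surjection from Baire space, given by its graph:
`Names p x` says that `p` is a name of `x`. -/
class RepresentedSpace (X : Type*) where
  Names : Baire → X → Prop
  unique : ∀ {p x y}, Names p x → Names p y → x = y
  surj : ∀ x, ∃ p, Names p x


open RepresentedSpace (Names)

/-- The subspace representation induced by an injection into a represented space. -/
@[reducible] def RepresentedSpace.induced {X Y : Type*} [RepresentedSpace Y] (i : X → Y)
    (hi : Function.Injective i) : RepresentedSpace X where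
  Names p x := Names p (i x)
  unique h h' := hi (RepresentedSpace.unique h h')
  surj x := RepresentedSpace.surj (i x)

/-- The natural numbers: a name of `n` is a sequence that starts with `n`. -/
instance : RepresentedSpace ℕ where
  Names p n := p 0 = n
  unique h h' := h.symm.trans h'
  surj n := ⟨fun _ => n, rfl⟩

/-- Sierpinski space is `Prop`, with `⊤ = True` and `⊥ = False`;
the only name of `⊥` is the zero sequence. -/
instance : RepresentedSpace Prop where
  Names p s := s ↔ ∃ n, p n ≠ 0
  unique h h' := propext (h.trans h'.symm)
  surj s := by
    by_cases hs : s
    · exact ⟨fun _ => 1, by simp [hs]⟩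
    · exact ⟨fun _ => 0, by simp [hs]⟩

/-- A standard numbering of the rationals, `⟨⟨a, b⟩, c⟩ ↦ (a - b) / (c + 1)`. -/
def ratNum (m : ℕ) : ℚ :=
  (((m.unpair.1.unpair.1 : ℕ) : ℚ) - ((m.unpair.1.unpair.2 : ℕ) : ℚ)) /
    (((m.unpair.2 : ℕ) : ℚ) + 1)

theorem ratNum_surjective : Function.Surjective ratNum := by
  intro q
  refine ⟨Nat.pair (Nat.pair q.num.toNat (-q.num).toNat) (q.den - 1), ?_⟩
  have h1 : ((q.den - 1 : ℕ) : ℚ) + 1 = q.den := by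
    have : (q.den - 1) + 1 = q.den := Nat.sub_add_cancel q.pos
    exact_mod_cast this
  have h2 : ((q.num.toNat : ℕ) : ℚ) - (((-q.num).toNat : ℕ) : ℚ) = q.num := by
    have : ((q.num.toNat : ℕ) : ℤ) - (((-q.num).toNat : ℕ) : ℤ) = q.num := by omega
    exact_mod_cast this
  simp only [ratNum, Nat.unpair_pair]
  rw [h1, h2]
  exact Rat.num_div_den q

/-- The Cauchy representation of the real numbers. -/
instance : RepresentedSpace ℝ where
  Names p x := ∀ n, |((ratNum (p n) : ℚ) : ℝ) - x| ≤ (1 / 2) ^ n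
  unique {p x y} h h' := by
    by_contra hxy
    have hpos : 0 < |x - y| / 2 := by
      have := abs_pos.mpr (sub_ne_zero.mpr hxy); linarith
    obtain ⟨n, hn⟩ := exists_pow_lt_of_lt_one hpos (by norm_num : (1 / 2 : ℝ) < 1)
    have h1 := h n
    have h2 := h' n
    have h3 : |x - y| ≤ |((ratNum (p n) : ℚ) : ℝ) - x| + |((ratNum (p n) : ℚ) : ℝ) - y| := by
      have := abs_sub_le x ((ratNum (p n) : ℚ) : ℝ) y
      rwa [abs_sub_comm x ((ratNum (p n) : ℚ) : ℝ)] at this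
    linarith
  surj x := by
    have key : ∀ n : ℕ, ∃ m, |((ratNum m : ℚ) : ℝ) - x| ≤ (1 / 2) ^ n := by
      intro n
      obtain ⟨q, hq1, hq2⟩ := exists_rat_btwn
        (show x < x + (1 / 2 : ℝ) ^ n by have : (0 : ℝ) < (1 / 2) ^ n := by positivity
                                         linarith)
      obtain ⟨m, rfl⟩ := ratNum_surjective q
      exact ⟨m, by rw [abs_of_pos (by linarith)]; linarith⟩
    choose p hp using key
    exact ⟨p, hp⟩

/-- The rational numbers as a subspace of the real numbers. -/
instance : RepresentedSpace ℚ := RepresentedSpace.induced (fun q : ℚ => (q : ℝ)) Rat.cast_injective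

section Spaces

variable (X Y : Type*) [RepresentedSpace X] [RepresentedSpace Y]

/-- The associate `α` computes a realizer of the (total, single-valued) function `f`. -/
def Tracks {X Y : Type*} [RepresentedSpace X] [RepresentedSpace Y] (α : Baire) (f : X → Y) :
    Prop :=
  ∀ p x, Names p x → ∃ q, Applies α p q ∧ Names q (f x)

/-- The space of continuous functions between represented spaces. -/
def ContFun : Type _ := {f : X → Y // ∃ α, Tracks α f}

/-- The function space representation: a name of `f` is an associate of a realizer of `f`. -/
instance : RepresentedSpace (ContFun X Y) where
  Names α f := Tracks α f.1
  unique {α f g} hf hg := by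
    refine Subtype.ext (funext fun x => ?_)
    obtain ⟨p, hp⟩ := RepresentedSpace.surj x
    obtain ⟨q, hq, hqf⟩ := hf p x hp
    obtain ⟨q', hq', hqg⟩ := hg p x hp
    rw [hq.unique hq'] at hqf
    exact RepresentedSpace.unique hqf hqg
  surj f := f.2

/-- The space of open subsets: a set is identified with its characteristic function into
Sierpinski space. -/
abbrev OpenSets : Type _ := ContFun X Prop

/-- The points of an open set. -/
def OpenSets.toSet {X : Type*} [RepresentedSpace X] (U : OpenSets X) : Set X := {x | U.1 x}

/-- `A` is topologically closed: its complement is an element of `OpenSets X`. -/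
def IsClosedSet {X : Type*} [RepresentedSpace X] (A : Set X) : Prop :=
  ∃ U : OpenSets X, U.toSet = Aᶜ

/-- The space of closed subsets with negative information: a name of `A` is a name of the
complement of `A` as an open set. -/
def ClosedSets : Type _ := {A : Set X // IsClosedSet A}

instance : RepresentedSpace (ClosedSets X) where
  Names p A := ∃ U : OpenSets X, U.toSet = A.1ᶜ ∧ Names p U
  unique {p A B} := by
    rintro ⟨U, hU, hpU⟩ ⟨V, hV, hpV⟩
    obtain rfl := RepresentedSpace.unique hpU hpV
    exact Subtype.ext (compl_injective (hU.symm.trans hV))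
  surj A := by
    obtain ⟨U, hU⟩ := A.2
    obtain ⟨p, hp⟩ := RepresentedSpace.surj U
    exact ⟨p, U, hU, hp⟩

/-- The predicate "`U` intersects `A`" on open sets `U`. -/
def Hits {X : Type*} [RepresentedSpace X] (A : Set X) (U : OpenSets X) : Prop :=
  (U.toSet ∩ A).Nonempty

/-- For every `A ⊆ X` the predicate `Hits A` is an open subset of the space of open sets. -/
theorem exists_tracks_hits {X : Type*} [RepresentedSpace X] (A : Set X) :
    ∃ α, Tracks α (Hits A) := by
  classical
  let code : Baire → ℕ → ℕ → ℕ := fun p m k => Nat.pair m (Encodable.encode (prefixOf p k))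
  -- the word `w`, a prefix of a name of `U`, confirms that some point of `A` lies in `U`
  let Good : List ℕ → Prop := fun w => ∃ x ∈ A, ∃ p, Names p x ∧ ∃ m k v,
    w[code p m k]? = some (v + 2) ∧ ∀ j < k, w[code p m j]? = some 0
  let α : Baire := fun c =>
    match (Encodable.decode c.unpair.2 : Option (List ℕ)) with
    | none => 0
    | some w => if w.length = c.unpair.1 then (if Good w then 2 else 1) else 0
  have hα : ∀ n w, α (Nat.pair n (Encodable.encode w)) =
      if w.length = n then (if Good w then 2 else 1) else 0 := by
    intro n w
    simp only [α, Nat.unpair_pair, Encodable.encodek]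
  have hlen : ∀ (p : Baire) k, (prefixOf p k).length = k := by
    intro p k; simp [prefixOf]
  have hget : ∀ (p : Baire) k i v, (prefixOf p k)[i]? = some v ↔ i < k ∧ p i = v := by
    intro p k i v
    by_cases hik : i < k
    · simp [prefixOf, hik]
    · simp [prefixOf, hik]
  refine ⟨α, fun β U hβ => ?_⟩
  refine ⟨fun n => if Good (prefixOf β n) then 1 else 0, ?_, ?_⟩
  · intro n
    refine ⟨n, ?_, ?_⟩
    · rw [hα, if_pos (hlen β n)]
      by_cases hG : Good (prefixOf β n) <;> simp [hG]
    · intro j hj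
      rw [hα, if_neg (by rw [hlen]; exact hj.ne)]
  · constructor
    · rintro ⟨x, hxU, hxA⟩
      obtain ⟨p, hp⟩ := RepresentedSpace.surj x
      obtain ⟨r, hr, hrU⟩ := hβ p x hp
      obtain ⟨m, hm⟩ := hrU.1 hxU
      obtain ⟨k, hk, hk0⟩ := hr m
      obtain ⟨v, hv⟩ := Nat.exists_eq_succ_of_ne_zero hm
      refine ⟨(Finset.range (k + 1)).sup (code p m) + 1, ?_⟩
      have hle : ∀ j ≤ k, code p m j < (Finset.range (k + 1)).sup (code p m) + 1 := fun j hj =>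
        Nat.lt_succ_of_le (Finset.le_sup (Finset.mem_range.2 (Nat.lt_succ_of_le hj)))
      have hG : Good (prefixOf β ((Finset.range (k + 1)).sup (code p m) + 1)) := by
        refine ⟨x, hxA, p, hp, m, k, v, (hget _ _ _ _).2 ⟨hle k le_rfl, ?_⟩,
          fun j hj => (hget _ _ _ _).2 ⟨hle j hj.le, hk0 j hj⟩⟩
        rw [hv] at hk
        exact hk
      exact ne_of_eq_of_ne (if_pos hG) one_ne_zero
    · rintro ⟨n, hn⟩
      have hG : Good (prefixOf β n) := by
        by_contra hG
        exact hn (if_neg hG)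
      obtain ⟨x, hxA, p, hp, m, k, v, hk, hk0⟩ := hG
      obtain ⟨r, hr, hrU⟩ := hβ p x hp
      obtain ⟨k', hk', hk0'⟩ := hr m
      have h1 : β (code p m k) = v + 2 := ((hget _ _ _ _).1 hk).2
      have h2 : ∀ j < k, β (code p m j) = 0 := fun j hj => ((hget _ _ _ _).1 (hk0 j hj)).2
      have hkk : k = k' := by
        rcases lt_trichotomy k k' with hlt | heq | hlt
        · have h3 : β (code p m k) = 0 := hk0' k hlt
          omega
        · exact heq
        · have h3 := h2 k' hlt
          have h4 : β (code p m k') = r m + 1 := hk'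
          omega
      subst hkk
      have h4 : β (code p m k) = r m + 1 := hk'
      exact ⟨x, hrU.2 ⟨m, by omega⟩, hxA⟩

/-- The space of overt sets: its points are the topologically closed sets `A`. -/
def OvertSets : Type _ := {A : Set X // IsClosedSet A}

/-- An overt set `A` as the open set of all open sets that intersect `A`. -/
def OvertSets.hits {X : Type*} [RepresentedSpace X] (A : OvertSets X) : OpenSets (OpenSets X) :=
  ⟨Hits A.1, exists_tracks_hits A.1⟩

theorem OvertSets.hits_injective {X : Type*} [RepresentedSpace X] :
    Function.Injective (OvertSets.hits (X := X)) := by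
  have key : ∀ A B : OvertSets X, A.hits = B.hits → A.1 ⊆ B.1 := by
    intro A B h x hx
    by_contra hxB
    obtain ⟨U, hU⟩ := B.2
    have h1 : Hits A.1 U := ⟨x, by rw [hU]; exact hxB, hx⟩
    have h2 : Hits A.1 U = Hits B.1 U := congrFun (congrArg Subtype.val h) U
    rw [h2] at h1
    obtain ⟨y, hy, hyB⟩ := h1
    rw [hU] at hy
    exact hy hyB
  intro A B h
  exact Subtype.ext ((key A B h).antisymm (key B A h.symm))

/-- Overt sets carry the subspace representation of `OpenSets (OpenSets X)`. -/
instance : RepresentedSpace (OvertSets X) :=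
  RepresentedSpace.induced OvertSets.hits OvertSets.hits_injective

end Spaces

/-- Partial multivalued functions; the domain of `f` is `{x | (f x).Nonempty}`. -/
abbrev MultiFun (X Y : Type*) : Type _ := X → Set Y

/-- The partial function `F` on Baire space is a realizer of `f`. -/
def Realizes {X Y : Type*} [RepresentedSpace X] [RepresentedSpace Y]
    (F : Baire →. Baire) (f : MultiFun X Y) : Prop :=
  ∀ p x, Names p x → (f x).Nonempty → ∃ q ∈ F p, ∃ y ∈ f x, Names q y

/-- The pairing `⟨p, q⟩ = p 0, q 0, p 1, q 1, …` on Baire space. -/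
def pairing (p q : Baire) : Baire := fun n => if n % 2 = 0 then p (n / 2) else q (n / 2)

/-- The partial function `p ↦ K ⟨p, G (H p)⟩`. -/
def sandwich (K G H : Baire →. Baire) : Baire →. Baire :=
  fun p => (H p).bind fun h => (G h).bind fun g => K (pairing p g)

/-- Weihrauch reducibility of `f` to `g`. -/
def WeihrauchLE {X Y U V : Type*} [RepresentedSpace X] [RepresentedSpace Y]
    [RepresentedSpace U] [RepresentedSpace V] (f : MultiFun X Y) (g : MultiFun U V) : Prop :=
  ∃ H K : Baire →. Baire, ComputableOp H ∧ ComputableOp K ∧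
    ∀ G : Baire →. Baire, Realizes G g → Realizes (sandwich K G H) f

/-- Weihrauch equivalence. -/
def WeihrauchEquiv {X Y U V : Type*} [RepresentedSpace X] [RepresentedSpace Y]
    [RepresentedSpace U] [RepresentedSpace V] (f : MultiFun X Y) (g : MultiFun U V) : Prop :=
  WeihrauchLE f g ∧ WeihrauchLE g f

/-- Weihrauch incomparability. -/
def WeihrauchIncomparable {X Y U V : Type*} [RepresentedSpace X] [RepresentedSpace Y]
    [RepresentedSpace U] [RepresentedSpace V] (f : MultiFun X Y) (g : MultiFun U V) : Prop :=
  ¬ WeihrauchLE f g ∧ ¬ WeihrauchLE g f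

/-- Closed choice: find a point of a nonempty closed set, given by negative information. -/
def closedChoice (X : Type*) [RepresentedSpace X] : MultiFun (ClosedSets X) X := fun A => A.1

/-- Overt choice: find a point of a nonempty closed set, given as an overt set. -/
def overtChoice (X : Type*) [RepresentedSpace X] : MultiFun (OvertSets X) X := fun A => A.1

end OvertChoice

namespace OvertChoice

open RepresentedSpace (Names)

/-! Both separations are continuity arguments: they discard the computability of the reduction and
use only its finite moduli.

Suppose overt choice on `ℚ` reduced to `C_ℕ`. Overt sets are presented by enumerations of balls
(`Enumerates.names`). That a guess `n` is wrong is seen from finitely much of the enumeration, so a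
Baire category argument (`exists_uniform_guess`) finds one `n` that is right on a whole cylinder.
With `n` fixed, the reduction becomes a continuous selection on that cylinder.
`not_exists_continuousSelection` defeats it: whenever the device commits to a point `x`, replace `x`
by two fresh nearby points, wait for it to commit to one of them, and keep the other. The committed
points escape every rational, so the kept points form a closed set containing no possible answer.

Conversely, suppose `C_ℕ` reduced to overt choice on `ℚ`. The output on the full set `ℕ` depends on
a finite part of the name and on a ball around one point of the overt set. Removing that output from
`ℕ` later leaves the ball hit, and the same wrong output recurs.

The equivalence pulls closed sets back along a numbering of `ℚ`, and embeds `ℕ` in `ℚ` as a closed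
set, decoded by rounding. -/

/-! ### Associates and their moduli of continuity -/

theorem length_prefixOf (p : Baire) (k : ℕ) : (prefixOf p k).length = k := by simp [prefixOf]

theorem getElem?_prefixOf (p : Baire) (k i v : ℕ) :
    (prefixOf p k)[i]? = some v ↔ i < k ∧ p i = v := by
  by_cases hik : i < k <;> simp [prefixOf, hik]

theorem prefixOf_congr {p p' : Baire} {k : ℕ} (h : ∀ i < k, p i = p' i) :
    prefixOf p k = prefixOf p' k :=
  List.map_congr_left fun i hi => h i (List.mem_range.1 hi)

/-- The query about the output symbol `n` on the prefix of length `k` of `p`. -/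
def query (p : Baire) (n k : ℕ) : ℕ := Nat.pair n (Encodable.encode (prefixOf p k))

theorem first_answer_unique {a : ℕ → ℕ} {k k' u v : ℕ} (h : a k = u + 1) (h0 : ∀ j < k, a j = 0)
    (h' : a k' = v + 1) (h0' : ∀ j < k', a j = 0) : u = v := by
  rcases lt_trichotomy k k' with hlt | rfl | hlt
  · have := h0' k hlt; omega
  · omega
  · have := h0 k' hlt; omega

/-- Each output symbol depends only on finite parts of the associate and of the input. -/
theorem Applies.exists_modulus {α p q : Baire} (h : Applies α p q) (n : ℕ) :
    ∃ k, ∀ α' p' q', (∀ i < k, α i = α' i) → (∀ i < k, p i = p' i) → Applies α' p' q' →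
      q' n = q n := by
  obtain ⟨k, hk, hk0⟩ := h n
  -- The first `k` input symbols fix the relevant queries; the second bound exceeds their codes and
  -- so fixes the answers.
  refine ⟨max k ((Finset.range (k + 1)).sup (query p n) + 1), fun α' p' q' hα hp h' => ?_⟩
  obtain ⟨k', hk', hk0'⟩ := h' n
  have key : ∀ j ≤ k, α' (query p' n j) = α (query p n j) := by
    intro j hj
    have h1 : query p' n j = query p n j := by
      unfold query
      rw [prefixOf_congr fun i hi => hp i (lt_max_of_lt_left (hi.trans_le hj))]
    rw [h1]
    exact (hα _ (lt_max_of_lt_right (Nat.lt_succ_of_le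
      (Finset.le_sup (Finset.mem_range.2 (Nat.lt_succ_of_le hj)))))).symm
  exact first_answer_unique (a := fun j => α' (query p' n j)) hk' hk0'
    ((key k le_rfl).trans hk) fun j hj => (key j hj.le).trans (hk0 j hj)

theorem Applies.exists_modulus_lt {α p q : Baire} (h : Applies α p q) (N : ℕ) :
    ∃ k, ∀ p' q', (∀ i < k, p i = p' i) → Applies α p' q' → ∀ n < N, q n = q' n := by
  choose m hm using h.exists_modulus
  refine ⟨(Finset.range N).sup m, fun p' q' hp h' n hn => ?_⟩
  exact (hm n α p' q' (fun _ _ => rfl) (fun i hi => hp i (hi.trans_le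
    (Finset.le_sup (Finset.mem_range.2 hn)))) h').symm

/-- The operation coded by an associate. -/
noncomputable def opOf (α : Baire) : Baire →. Baire :=
  fun p => ⟨∃ q, Applies α p q, fun h => h.choose⟩

theorem mem_opOf {α p q : Baire} : q ∈ opOf α p ↔ Applies α p q := by
  constructor
  · rintro ⟨h, rfl⟩
    exact h.choose_spec
  · intro h
    exact ⟨⟨q, h⟩, Applies.unique (Exists.choose_spec (⟨q, h⟩ : ∃ q, Applies α p q)) h⟩

/-! ### Weihrauch reductions in terms of associates -/

section Weihrauch

variable {X Y U V : Type*} [RepresentedSpace X] [RepresentedSpace Y]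
  [RepresentedSpace U] [RepresentedSpace V]

/-- `αH` and `αK` witness a reduction of `f` to `g`. -/
def Reduces (αH αK : Baire) (f : MultiFun X Y) (g : MultiFun U V) : Prop :=
  ∀ p x, Names p x → (f x).Nonempty → ∃ h u, Applies αH p h ∧ Names h u ∧ (g u).Nonempty ∧
    ∀ v ∈ g u, ∀ s, Names s v → ∃ r, Applies αK (pairing p s) r ∧ ∃ y ∈ f x, Names r y

/-- A realizer of `g` may be altered at the single name `h` to return any correct answer `s`.
Applying the reduction to each altered realizer turns the quantifier over realizers into one over
answers. -/
theorem WeihrauchLE.exists_reduces {f : MultiFun X Y} {g : MultiFun U V} (h : WeihrauchLE f g) :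
    ∃ αH αK, Reduces αH αK f g := by
  classical
  obtain ⟨H, K, ⟨αH, -, hH⟩, ⟨αK, -, hK⟩, hG⟩ := h
  refine ⟨αH, αK, fun p x hp hx => ?_⟩
  have ex : ∀ t : Baire, (∃ u, Names t u ∧ (g u).Nonempty) →
      ∃ s : Baire, ∀ u, Names t u → ∃ v ∈ g u, Names s v := by
    rintro t ⟨u, hu, v, hv⟩
    obtain ⟨s, hs⟩ := RepresentedSpace.surj v
    exact ⟨s, fun u' hu' => ⟨v, RepresentedSpace.unique hu hu' ▸ hv, hs⟩⟩
  let G : Baire →. Baire := fun t =>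
    ⟨∃ u, Names t u ∧ (g u).Nonempty, fun ht => (ex t ht).choose⟩
  have hGr : Realizes G g := fun t u hu hne =>
    ⟨_, ⟨⟨u, hu, hne⟩, rfl⟩, (ex t ⟨u, hu, hne⟩).choose_spec u hu⟩
  obtain ⟨q, hq, -⟩ := hG G hGr p x hp hx
  obtain ⟨h, hh, hq⟩ := Part.mem_bind_iff.1 hq
  obtain ⟨s, ⟨⟨u, hu, hne⟩, -⟩, -⟩ := Part.mem_bind_iff.1 hq
  refine ⟨h, u, hH p h hh, hu, hne, fun v hv s hs => ?_⟩
  have hGr' : Realizes (fun t => if t = h then Part.some s else G t) g := by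
    intro t u' hu' hne'
    by_cases ht : t = h
    · subst ht
      exact ⟨s, by simp, v, RepresentedSpace.unique hu hu' ▸ hv, hs⟩
    · simpa [ht] using hGr t u' hu' hne'
  obtain ⟨q, hq, y, hy, hqy⟩ := hG _ hGr' p x hp hx
  obtain ⟨h', hh', hq⟩ := Part.mem_bind_iff.1 hq
  obtain rfl := Part.mem_unique hh hh'
  obtain ⟨s', hs', hqK⟩ := Part.mem_bind_iff.1 hq
  obtain rfl : s' = s := by simpa using hs'
  exact ⟨q, hK _ _ hqK, y, hy, hqy⟩

theorem Reduces.weihrauchLE {f : MultiFun X Y} {g : MultiFun U V} {αH αK : Baire}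
    (h : Reduces αH αK f g) (hH : Computable αH) (hK : Computable αK) : WeihrauchLE f g := by
  refine ⟨opOf αH, opOf αK, ⟨αH, hH, fun _ _ => mem_opOf.1⟩, ⟨αK, hK, fun _ _ => mem_opOf.1⟩,
    fun G hG p x hp hx => ?_⟩
  obtain ⟨t, u, ht, hu, hne, hr⟩ := h p x hp hx
  obtain ⟨s, hs, v, hv, hsv⟩ := hG t u hu hne
  obtain ⟨r, hr, y, hy, hry⟩ := hr v hv s hsv
  exact ⟨r, Part.mem_bind_iff.2 ⟨t, mem_opOf.2 ht, Part.mem_bind_iff.2 ⟨s, hs, mem_opOf.2 hr⟩⟩,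
    y, hy, hry⟩

end Weihrauch

/-! ### Constructing associates -/

/-- Operations whose `n`-th output symbol is computed from one input symbol are computable. -/
theorem exists_computable_applies {φ : ℕ → ℕ} {g : ℕ → ℕ → ℕ} (hφ : Computable φ)
    (hg : Computable₂ g) :
    ∃ α, Computable α ∧ ∀ p : Baire, Applies α p (fun n => g n (p (φ n))) := by
  let α : Baire := fun c =>
    (((Encodable.decode c.unpair.2 : Option (List ℕ)).bind
      fun w => w[φ c.unpair.1]?).map fun a => g c.unpair.1 a + 1).getD 0
  have hfst : Computable fun c : ℕ => c.unpair.1 := (Primrec.fst.comp Primrec.unpair).to_comp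
  refine ⟨α, ?_, fun p n => ⟨φ n + 1, ?_, fun j hj => ?_⟩⟩
  · refine Computable.option_getD (Computable.option_map (Computable.option_bind ?_ ?_) ?_)
      (Computable.const 0)
    · exact (Primrec.decode.comp (Primrec.snd.comp Primrec.unpair)).to_comp
    · exact Primrec.list_getElem?.to_comp.comp Computable.snd
        (hφ.comp (hfst.comp Computable.fst))
    · exact Computable.succ.comp (hg.comp (hfst.comp Computable.fst) Computable.snd)
  · have : (prefixOf p (φ n + 1))[φ n]? = some (p (φ n)) :=
      (getElem?_prefixOf _ _ _ _).2 ⟨Nat.lt_succ_self _, rfl⟩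
    simp only [α, Nat.unpair_pair, Encodable.encodek, Option.bind_some, this, Option.map_some,
      Option.getD_some]
  · have : (prefixOf p j)[φ n]? = none := by
      rw [List.getElem?_eq_none_iff, length_prefixOf]; omega
    simp only [α, Nat.unpair_pair, Encodable.encodek, Option.bind_some, this, Option.map_none,
      Option.getD_none]

/-- The associate that outputs, at stage `n`, whether the prefix of length `n` is good. -/
noncomputable def stagewise (Good : List ℕ → Prop) : Baire := by
  classical exact fun c =>
    match (Encodable.decode c.unpair.2 : Option (List ℕ)) with
    | none => 0
    | some w => if w.length = c.unpair.1 then (if Good w then 2 else 1) else 0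

theorem applies_stagewise (Good : List ℕ → Prop) (p : Baire) :
    ∃ q, Applies (stagewise Good) p q ∧ ∀ n, q n ≠ 0 ↔ Good (prefixOf p n) := by
  classical
  have hα : ∀ n w, stagewise Good (Nat.pair n (Encodable.encode w)) =
      if w.length = n then (if Good w then 2 else 1) else 0 := by
    intro n w
    simp only [stagewise, Nat.unpair_pair, Encodable.encodek]
  refine ⟨fun n => if Good (prefixOf p n) then 1 else 0, fun n => ⟨n, ?_, fun j hj => ?_⟩,
    fun n => by simp⟩
  · rw [hα, if_pos (length_prefixOf p n)]
    by_cases hG : Good (prefixOf p n) <;> simp [hG]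
  · rw [hα, if_neg (by rw [length_prefixOf]; exact hj.ne)]

/-- The value at `c` consults only words of length `c.unpair.1 ≤ c`. This allows names of different
sets to share long prefixes. -/
theorem stagewise_congr {Good Good' : List ℕ → Prop} {c : ℕ}
    (h : ∀ w : List ℕ, w.length ≤ c → (Good w ↔ Good' w)) :
    stagewise Good c = stagewise Good' c := by
  unfold stagewise
  rcases (Encodable.decode c.unpair.2 : Option (List ℕ)) with _ | w
  · rfl
  · by_cases hw : w.length = c.unpair.1
    · have := h w (hw.trans_le (Nat.unpair_left_le c))
      by_cases hG : Good w <;> simp [hw, hG, ← this]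
    · simp [hw]

/-! ### Names, closed sets and balls of rationals -/

theorem names_rat_iff {p : Baire} {x : ℚ} :
    Names p x ↔ ∀ n, |ratNum (p n) - x| ≤ (1 / 2) ^ n := by
  refine forall_congr' fun n => ?_
  rw [← Rat.cast_le (K := ℝ)]
  push_cast
  rfl

theorem names_const_rat (m : ℕ) : Names (fun _ => m) (ratNum m) :=
  names_rat_iff.2 fun n => by simp

theorem exists_half_pow_lt {ε : ℚ} (hε : 0 < ε) : ∃ n : ℕ, (1 / 2 : ℚ) ^ n < ε :=
  exists_pow_lt_of_lt_one hε (by norm_num)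

/-- Points outside of `A` have a positive distance from `A`. -/
def SeparatesPoints (A : Set ℚ) : Prop := ∀ z ∉ A, ∃ ε > 0, ∀ y ∈ A, ε ≤ |y - z|

theorem separatesPoints_finset (F : Finset ℚ) : SeparatesPoints (F : Set ℚ) := by
  induction F using Finset.induction_on with
  | empty => exact fun z _ => ⟨1, one_pos, by simp⟩
  | insert a F _ ih =>
    intro z hz
    rw [Finset.mem_coe, Finset.mem_insert, not_or] at hz
    obtain ⟨ε, hε, h⟩ := ih z hz.2
    refine ⟨min ε |a - z|, lt_min hε (abs_pos.2 (sub_ne_zero.2 (Ne.symm hz.1))), fun y hy => ?_⟩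
    rcases Finset.mem_insert.1 hy with rfl | hy
    · exact min_le_right _ _
    · exact (min_le_left _ _).trans (h y hy)

/-- Metrically open sets of rationals are points of `OpenSets ℚ`. -/
theorem exists_openSets {O : Set ℚ} (hO : ∀ x ∈ O, ∃ ε > 0, ∀ y, |y - x| < ε → y ∈ O) :
    ∃ U : OpenSets ℚ, U.toSet = O := by
  refine ⟨⟨fun x => x ∈ O, stagewise fun w => ∃ i < w.length, ∀ y : ℚ,
    |ratNum (w.getD i 0) - y| ≤ (1 / 2) ^ i → y ∈ O, fun p x hp => ?_⟩, rfl⟩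
  obtain ⟨q, hq, hG⟩ := applies_stagewise (fun w => ∃ i < w.length, ∀ y : ℚ,
    |ratNum (w.getD i 0) - y| ≤ (1 / 2) ^ i → y ∈ O) p
  refine ⟨q, hq, ?_, ?_⟩
  · intro hx
    obtain ⟨ε, hε, h⟩ := hO x hx
    obtain ⟨i, hi⟩ := exists_half_pow_lt (half_pos hε)
    refine ⟨i + 1, (hG _).2 ⟨i, by rw [length_prefixOf]; exact Nat.lt_succ_self i, fun y hy => ?_⟩⟩
    have h1 : (prefixOf p (i + 1)).getD i 0 = p i := by simp [prefixOf]
    rw [h1] at hy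
    have h2 := names_rat_iff.1 hp i
    apply h
    rw [abs_sub_comm] at hy
    have := abs_sub_le y (ratNum (p i)) x
    linarith
  · rintro ⟨n, hn⟩
    obtain ⟨i, hi, h⟩ := (hG n).1 hn
    rw [length_prefixOf] at hi
    apply h
    have h1 : (prefixOf p n).getD i 0 = p i := by simp [prefixOf, hi]
    rw [h1]
    exact names_rat_iff.1 hp i

theorem SeparatesPoints.isClosedSet {A : Set ℚ} (hA : SeparatesPoints A) : IsClosedSet A :=
  exists_openSets fun x hx => by
    obtain ⟨ε, hε, h⟩ := hA x hx
    exact ⟨ε, hε, fun y hy hyA => (h y hyA).not_gt hy⟩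

/-- The basic open ball with code `c`. -/
def codedBall (c : ℕ) : Set ℚ := {y | |y - ratNum c.unpair.1| < (1 / 2) ^ c.unpair.2}

theorem center_mem_codedBall (c : ℕ) : ratNum c.unpair.1 ∈ codedBall c := by
  simp [codedBall]

theorem exists_subset_codedBall {c : ℕ} {x : ℚ} (hx : x ∈ codedBall c) :
    ∃ ε > 0, ∀ y, |y - x| < ε → y ∈ codedBall c := by
  refine ⟨(1 / 2) ^ c.unpair.2 - |x - ratNum c.unpair.1|, sub_pos.2 hx, fun y hy => ?_⟩
  have := abs_sub_le y x (ratNum c.unpair.1)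
  show |y - ratNum c.unpair.1| < _
  linarith

theorem exists_codedBall (x : ℚ) (j : ℕ) :
    ∃ c, x ∈ codedBall c ∧ ∀ y ∈ codedBall c, |y - x| < (1 / 2) ^ j := by
  obtain ⟨m, rfl⟩ := ratNum_surjective x
  exact ⟨Nat.pair m j, by simp [codedBall], fun y hy => by simpa [codedBall] using hy⟩

/-- A rational close to the point named by `m, m, m, …` has a name with a long prefix of `m`s. -/
theorem exists_names_of_close {m k : ℕ} {y : ℚ} (hy : |y - ratNum m| < (1 / 2) ^ k) :
    ∃ p : Baire, Names p y ∧ ∀ i < k, m = p i := by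
  obtain ⟨m', rfl⟩ := ratNum_surjective y
  refine ⟨fun i => if i < k then m else m', names_rat_iff.2 fun n => ?_, fun i hi => by simp [hi]⟩
  by_cases hn : n < k
  · simp only [hn, if_true]
    rw [abs_sub_comm]
    exact hy.le.trans (pow_le_pow_of_le_one (by norm_num) (by norm_num) hn.le)
  · simp [hn]

/-! ### Overt sets from enumerations of balls -/

/-- `e` enumerates codes of balls that intersect `A`, arbitrarily small ones at each point. -/
structure Enumerates (e : Baire) (A : Set ℚ) : Prop where
  hits : ∀ i, ∃ x ∈ A, x ∈ codedBall (e i)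
  small : ∀ x ∈ A, ∀ j, ∃ i, ∀ y ∈ codedBall (e i), |y - x| < (1 / 2) ^ j

/-- The word `w`, a prefix of a name of an open set, confirms that `x` lies in that set. -/
def Confirms (w : List ℕ) (x : ℚ) : Prop :=
  ∃ p, Names p x ∧ ∃ n k v, w[query p n k]? = some (v + 2) ∧ ∀ j < k, w[query p n j]? = some 0

/-- The name of an overt set obtained from an enumeration of balls. -/
noncomputable def overtName (e : Baire) : Baire :=
  stagewise fun w => ∃ i < w.length, ∀ y ∈ codedBall (e i), Confirms w y

theorem overtName_congr {e e' : Baire} {k : ℕ} (h : ∀ i < k, e i = e' i) :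
    ∀ c < k, overtName e c = overtName e' c := fun c hc =>
  stagewise_congr fun w hw => exists_congr fun i => and_congr_right fun hi => by
    rw [h i (hi.trans_le (hw.trans hc.le))]

/-- If `U` contains a point `x` of `A`, this is recognised on finitely many symbols of a constant
name of `x`. All points of a small ball around `x` have names with that prefix, so an enumerated
ball is confirmed. Conversely, a confirmed ball lies in `U` and contains a point of `A`. -/
theorem Enumerates.names {e : Baire} {A : OvertSets ℚ} (he : Enumerates e A.1) :
    Names (overtName e) A := by
  intro β U hβ
  obtain ⟨q, hq, hG⟩ :=
    applies_stagewise (fun w => ∃ i < w.length, ∀ y ∈ codedBall (e i), Confirms w y) β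
  refine ⟨q, hq, ?_, ?_⟩
  · rintro ⟨x, hxU, hxA⟩
    obtain ⟨m, rfl⟩ := ratNum_surjective x
    obtain ⟨r, hr, hrU⟩ := hβ _ _ (names_const_rat m)
    obtain ⟨n, hn⟩ := hrU.1 hxU
    obtain ⟨k, hk, hk0⟩ := hr n
    obtain ⟨v, hv⟩ := Nat.exists_eq_succ_of_ne_zero hn
    obtain ⟨i, hi⟩ := he.small _ hxA k
    set c := query (fun _ => m) n with hc
    have hle : ∀ j ≤ k, c j < max (i + 1) ((Finset.range (k + 1)).sup c + 1) := fun j hj =>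
      lt_max_of_lt_right (Nat.lt_succ_of_le
        (Finset.le_sup (Finset.mem_range.2 (Nat.lt_succ_of_le hj))))
    refine ⟨max (i + 1) ((Finset.range (k + 1)).sup c + 1), (hG _).2 ⟨i, ?_, fun y hy => ?_⟩⟩
    · rw [length_prefixOf]
      exact lt_max_of_lt_left (Nat.lt_succ_self i)
    · obtain ⟨p, hp, hpk⟩ := exists_names_of_close (hi y hy)
      have hcp : ∀ j ≤ k, query p n j = c j := fun j hj => by
        rw [hc, query, query, prefixOf_congr fun i hi => hpk i (hi.trans_le hj)]
      refine ⟨p, hp, n, k, v, ?_, fun j hj => ?_⟩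
      · rw [hcp k le_rfl, getElem?_prefixOf]
        refine ⟨hle k le_rfl, hk.trans ?_⟩
        rw [hv]
      · rw [hcp j hj.le, getElem?_prefixOf]
        exact ⟨hle j hj.le, hk0 j hj⟩
  · rintro ⟨n, hn⟩
    obtain ⟨i, -, hi⟩ := (hG n).1 hn
    obtain ⟨x, hxA, hx⟩ := he.hits i
    obtain ⟨p, hp, m, k, v, hk, hk0⟩ := hi x hx
    obtain ⟨r, hr, hrU⟩ := hβ p x hp
    obtain ⟨k', hk', hk0'⟩ := hr m
    have h1 : v + 1 = r m := first_answer_unique (a := fun j => β (query p m j))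
      ((getElem?_prefixOf _ _ _ _).1 hk).2 (fun j hj => ((getElem?_prefixOf _ _ _ _).1 (hk0 j hj)).2)
      hk' hk0'
    exact ⟨x, hrU.2 ⟨m, by omega⟩, hxA⟩

/-! ### Limits of finite extensions and the category argument -/

/-- A coherent sequence of finite words of growing length has a limit. -/
theorem exists_limit (e : ℕ → Baire) (l : ℕ → ℕ) (hl : ∀ n, l n < l (n + 1))
    (he : ∀ n, ∀ i < l n, e n i = e (n + 1) i) : ∃ e' : Baire, ∀ n, ∀ i < l n, e n i = e' i := by
  have hmono : StrictMono l := strictMono_nat_of_lt_succ hl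
  have key : ∀ d n, ∀ i < l n, e n i = e (n + d) i := by
    intro d
    induction d with
    | zero => exact fun _ _ _ => rfl
    | succ d ih =>
      intro n i hi
      exact (ih n i hi).trans (he (n + d) i (hi.trans_le (hmono.monotone (Nat.le_add_right n d))))
  refine ⟨fun i => e (i + 1) i, fun n i hi => ?_⟩
  have h1 : i < l (i + 1) := (Nat.lt_succ_self i).trans_le (hmono.le_apply)
  rcases le_total n (i + 1) with h | h
  · obtain ⟨d, hd⟩ := Nat.exists_eq_add_of_le h
    simpa only [hd] using key d n i hi
  · obtain ⟨d, hd⟩ := Nat.exists_eq_add_of_le h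
    simpa only [hd] using (key d (i + 1) i h1).symm

theorem exists_sequence {S : Type*} {R : ℕ → S → S → Prop} (s₀ : S)
    (h : ∀ n s, ∃ t, R n s t) : ∃ s : ℕ → S, s 0 = s₀ ∧ ∀ n, R n (s n) (s (n + 1)) := by
  choose f hf using h
  exact ⟨fun n => Nat.rec s₀ f n, rfl, fun n => hf n _⟩

/-- If every enumeration of a nonempty closed set determines a nonempty set of guesses, with
negative information, then some guess is right for all enumerations with some prefix. -/
theorem exists_uniform_guess {Ans : Baire → ℕ → Prop}
    (hne : ∀ e, Enumerates e Set.univ → ∃ n, Ans e n)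
    (hopen : ∀ e A, Enumerates e A → SeparatesPoints A → A.Nonempty → ∀ n, ¬ Ans e n →
      ∃ k, ∀ e' : Baire, (∀ i < k, e i = e' i) → ¬ Ans e' n) :
    ∃ (n : ℕ) (e₀ : Baire) (L : ℕ), ∀ e A, (∀ i < L, e₀ i = e i) → Enumerates e A →
      SeparatesPoints A → A.Nonempty → Ans e n := by
  by_contra! hcon
  -- Stage `n` refutes the guess `n` by a finite extension and also writes the code `n`. The limit
  -- therefore lists every ball, so it enumerates `ℚ` while all guesses are refuted.
  obtain ⟨s, -, hs⟩ := exists_sequence (S := Baire × ℕ) (R := fun n s t =>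
    s.2 < t.2 ∧ (∀ i < s.2, s.1 i = t.1 i) ∧ t.1 s.2 = n ∧
      ∀ e', (∀ i < t.2, t.1 i = e' i) → ¬ Ans e' n) (fun _ => 0, 0) (by
    rintro n ⟨e, l⟩
    obtain ⟨e₁, A, hag, hA, hcl, hAne, hn⟩ := hcon n (Function.update e l n) (l + 1)
    obtain ⟨k, hk⟩ := hopen e₁ A hA hcl hAne n hn
    refine ⟨(e₁, max k (l + 1)), lt_max_of_lt_right (Nat.lt_succ_self l), fun i hi => ?_, ?_,
      fun e' he' => hk e' fun i hi => he' i (lt_max_of_lt_left hi)⟩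
    · exact (Function.update_of_ne (ne_of_lt hi) n e).symm.trans (hag i (Nat.lt_succ_of_lt hi))
    · exact (hag l (Nat.lt_succ_self l)).symm.trans (Function.update_self l n e))
  obtain ⟨e, he⟩ := exists_limit (fun n => (s n).1) (fun n => (s n).2) (fun n => (hs n).1)
    fun n => (hs n).2.1
  have henum : Enumerates e Set.univ := by
    refine ⟨fun i => ⟨_, trivial, center_mem_codedBall _⟩, fun x _ j => ?_⟩
    obtain ⟨c, -, hc⟩ := exists_codedBall x j
    refine ⟨(s c).2, ?_⟩
    rw [← he (c + 1) _ (hs c).1, (hs c).2.2.1]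
    exact hc
  obtain ⟨n, hn⟩ := hne e henum
  exact (hs n).2.2.2 e (he (n + 1)) hn

/-! ### Defeating continuous selections -/

/-- `Res e y`: a continuous device answers the enumeration `e` with `y`. -/
def ContinuousSelection (Res : Baire → ℚ → Prop) : Prop :=
  ∀ e y, Res e y → ∀ ε > 0, ∃ k, ∀ (e' : Baire) (y' : ℚ), (∀ i < k, e i = e' i) → Res e' y' →
    |y' - y| < ε

theorem exists_bound_small {e : Baire} {F : Finset ℚ} (he : Enumerates e F) (j : ℕ) :
    ∃ N, ∀ s ∈ F, ∃ i < N, ∀ y ∈ codedBall (e i), |y - s| < (1 / 2) ^ j := by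
  have h : ∀ s : ℚ, ∃ i, s ∈ F → ∀ y ∈ codedBall (e i), |y - s| < (1 / 2) ^ j := by
    intro s
    by_cases hs : s ∈ F
    · obtain ⟨i, hi⟩ := he.small s hs j
      exact ⟨i, fun _ => hi⟩
    · exact ⟨0, fun h => absurd h hs⟩
  choose f hf using h
  exact ⟨F.sup f + 1, fun s hs => ⟨f s, Nat.lt_succ_of_le (Finset.le_sup hs), hf s hs⟩⟩

/-- Extend a finite enumeration to one of the finite set `F`, up to the point where the device
has committed itself to one point of `F`. -/
theorem exists_commit {Res : Baire → ℚ → Prop} (hcont : ContinuousSelection Res) {e₀ : Baire}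
    {L : ℕ} (hres : ∀ e A, (∀ i < L, e₀ i = e i) → Enumerates e A → SeparatesPoints A →
      A.Nonempty → ∃ y ∈ A, Res e y) (j : ℕ) {e : Baire} {l : ℕ} (hL : L ≤ l)
    (hag : ∀ i < L, e₀ i = e i) {F : Finset ℚ} (hF : F.Nonempty)
    (hcons : ∀ i < l, ∃ x ∈ F, x ∈ codedBall (e i)) :
    ∃ (e' : Baire) (l' : ℕ) (x : ℚ), (∀ i < l, e i = e' i) ∧ l < l' ∧ Enumerates e' F ∧ x ∈ F ∧
      Res e' x ∧ (∀ e'' y, (∀ i < l', e' i = e'' i) → Res e'' y → y ∉ F.erase x) ∧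
      ∀ s ∈ F, ∃ i < l', ∀ y ∈ codedBall (e' i), |y - s| < (1 / 2) ^ j := by
  classical
  obtain ⟨f, hf⟩ := hF
  obtain ⟨c₀, hc₀, -⟩ := exists_codedBall f 0
  -- After the fixed prefix, all codes are listed in order; balls missing `F` are replaced by the
  -- harmless `c₀`.
  let e' : Baire := fun i => if i < l then e i else
    if ∃ x ∈ F, x ∈ codedBall (i - l) then i - l else c₀
  have hee : ∀ i < l, e i = e' i := fun i hi => by simp [e', hi]
  have henum : Enumerates e' (F : Set ℚ) := by
    refine ⟨fun i => ?_, fun x hx j => ?_⟩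
    · by_cases hi : i < l
      · rw [← hee i hi]; exact hcons i hi
      · by_cases h : ∃ x ∈ F, x ∈ codedBall (i - l)
        · have : e' i = i - l := by simp only [e', hi, if_false, h, if_true]
          rw [this]
          exact h
        · simp only [e', hi, if_false, h]
          exact ⟨f, hf, hc₀⟩
    · obtain ⟨c, hxc, hc⟩ := exists_codedBall x j
      refine ⟨l + c, ?_⟩
      have h : ∃ x ∈ F, x ∈ codedBall c := ⟨x, hx, hxc⟩
      have : e' (l + c) = c := by simp [e', h]
      rwa [this]
  obtain ⟨x, hxF, hx⟩ := hres e' F (fun i hi => (hag i hi).trans (hee i (hi.trans_le hL))) henum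
    (separatesPoints_finset F) ⟨f, hf⟩
  -- An answer kept within `ε` of `x` can no longer be another point of `F`.
  obtain ⟨ε, hε, hsep⟩ := separatesPoints_finset (F.erase x) x (by simp)
  obtain ⟨k, hk⟩ := hcont e' x hx ε hε
  obtain ⟨N, hN⟩ := exists_bound_small henum j
  refine ⟨e', max k (max N (l + 1)), x, hee,
    lt_max_of_lt_right (lt_max_of_lt_right (Nat.lt_succ_self l)), henum, hxF, hx,
    fun e'' y hag' hy hyF => ?_, fun s hs => ?_⟩
  · exact (hsep y hyF).not_gt (hk e'' y (fun i hi => hag' i (lt_max_of_lt_left hi)) hy)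
  · obtain ⟨i, hi, h⟩ := hN s hs
    exact ⟨i, lt_max_of_lt_right (lt_max_of_lt_left hi), h⟩

theorem exists_notMem_close (T : Finset ℚ) (x : ℚ) {δ : ℚ} (hδ : 0 < δ) :
    ∃ y ∉ T, |y - x| < δ := by
  obtain ⟨y, ⟨h1, h2⟩, hy⟩ :=
    (Set.Ioo_infinite (show x - δ < x + δ by linarith)).exists_notMem_finset T
  exact ⟨y, hy, abs_sub_lt_iff.2 ⟨by linarith, by linarith⟩⟩

theorem exists_common_radius (e : Baire) (x : ℚ) {ρ : ℚ} (hρ : 0 < ρ) (l : ℕ) :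
    ∃ δ > 0, δ ≤ ρ ∧ ∀ i < l, x ∈ codedBall (e i) → ∀ y, |y - x| < δ → y ∈ codedBall (e i) := by
  induction l with
  | zero => exact ⟨ρ, hρ, le_rfl, fun i hi => absurd hi (Nat.not_lt_zero i)⟩
  | succ l ih =>
    obtain ⟨δ, hδ, hδρ, h⟩ := ih
    by_cases hx : x ∈ codedBall (e l)
    · obtain ⟨ε, hε, hb⟩ := exists_subset_codedBall hx
      refine ⟨min δ ε, lt_min hδ hε, (min_le_left _ _).trans hδρ, fun i hi hxi y hy => ?_⟩
      rcases Nat.lt_succ_iff_lt_or_eq.1 hi with hi | rfl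
      · exact h i hi hxi y (hy.trans_le (min_le_left _ _))
      · exact hb y (hy.trans_le (min_le_right _ _))
    · refine ⟨δ, hδ, hδρ, fun i hi hxi y hy => ?_⟩
      rcases Nat.lt_succ_iff_lt_or_eq.1 hi with hi | rfl
      · exact h i hi hxi y hy
      · exact absurd hxi hx

/-- A stage of the construction: the enumeration `e` is fixed up to `l`, the points of `S` are
settled, the device has committed itself outside of `S`, and all further points are to lie in the
ball of radius `ρ` around `x`. -/
structure Stage (Res : Baire → ℚ → Prop) (e₀ : Baire) (L : ℕ) where
  e : Baire
  l : ℕ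
  x : ℚ
  S : Finset ℚ
  ρ : ℚ
  hL : L ≤ l
  agree : ∀ i < L, e₀ i = e i
  hits : ∀ i < l, (∃ s ∈ S, s ∈ codedBall (e i)) ∨ x ∈ codedBall (e i)
  commit : ∀ (e' : Baire) (y : ℚ), (∀ i < l, e i = e' i) → Res e' y → y ∉ S
  pos : 0 < ρ

/-- One step of the construction, taking care of the point `z` and the precision `j`. -/
structure Stage.Step {Res : Baire → ℚ → Prop} {e₀ : Baire} {L : ℕ} (s t : Stage Res e₀ L)
    (z : ℚ) (j : ℕ) : Prop where
  lt : s.l < t.l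
  agree : ∀ i < s.l, s.e i = t.e i
  subset : s.S ⊆ t.S
  near : ∀ y ∈ t.S, y ∈ s.S ∨ |y - s.x| < s.ρ
  nested : ∀ y, |y - t.x| < t.ρ → |y - s.x| < s.ρ
  avoid : ∃ ε > 0, ∀ y, |y - t.x| < t.ρ → ε ≤ |y - z|
  hits : ∀ i < s.l, ∃ y ∈ t.S, y ∈ codedBall (s.e i)
  small : ∀ y ∈ t.S, ∃ i < t.l, ∀ y' ∈ codedBall (t.e i), |y' - y| < (1 / 2) ^ j

/-- Two fresh points `a`, `c` replace `s.x`, so close to it that they lie in every listed ball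
containing it. Shown `s.S` with `a` and `c`, the device must pick `a` or `c`, since it is committed
outside `s.S`. The pick becomes the new centre; the other point is settled and takes over the balls
around `s.x`. -/
theorem Stage.exists_step {Res : Baire → ℚ → Prop} (hcont : ContinuousSelection Res) {e₀ : Baire}
    {L : ℕ} (hres : ∀ e A, (∀ i < L, e₀ i = e i) → Enumerates e A → SeparatesPoints A →
      A.Nonempty → ∃ y ∈ A, Res e y) (s : Stage Res e₀ L) (z : ℚ) (j : ℕ) :
    ∃ t : Stage Res e₀ L, s.Step t z j := by
  -- Half of `s.ρ` pays for moving the centre, the other half for the new radius.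
  obtain ⟨δ, hδ, hδρ, hδe⟩ := exists_common_radius s.e s.x (half_pos s.pos) s.l
  -- Both fresh points avoid `z`, so a small enough new ball stays away from `z` whichever is
  -- picked.
  obtain ⟨c, hcT, hc⟩ := exists_notMem_close (insert z s.S) s.x hδ
  obtain ⟨a, haT, ha⟩ := exists_notMem_close (insert c (insert z s.S)) s.x hδ
  simp only [Finset.mem_insert, not_or] at hcT haT
  obtain ⟨e', l', x', hee, hll, henum, hxF, hxR, hcom, hsmall⟩ := exists_commit hcont hres j s.hL
    s.agree (F := insert a (insert c s.S)) ⟨a, by simp⟩ (by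
      intro i hi
      rcases s.hits i hi with ⟨y, hy, hyi⟩ | hx
      · exact ⟨y, by simp [hy], hyi⟩
      · exact ⟨a, by simp, hδe i hi hx a ha⟩)
  have hxS : x' ∉ s.S := s.commit e' x' hee hxR
  have hsub : s.S ⊆ (insert a (insert c s.S)).erase x' := fun y hy =>
    Finset.mem_erase.2 ⟨fun h => hxS (h ▸ hy), by simp [hy]⟩
  have hpt : x' ≠ z ∧ |x' - s.x| < δ ∧
      ∃ y ∈ (insert a (insert c s.S)).erase x', |y - s.x| < δ := by
    simp only [Finset.mem_insert] at hxF
    rcases hxF with rfl | rfl | h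
    · exact ⟨haT.2.1, ha, c, by simp [Ne.symm haT.1], hc⟩
    · exact ⟨hcT.1, hc, a, by simp [haT.1], ha⟩
    · exact absurd h hxS
  obtain ⟨hxz, hxδ, b, hbF, hb⟩ := hpt
  have hz : 0 < |x' - z| := abs_pos.2 (sub_ne_zero.2 hxz)
  refine ⟨⟨e', l', x', (insert a (insert c s.S)).erase x', min (s.ρ / 2) (|x' - z| / 2),
    s.hL.trans hll.le, fun i hi => (s.agree i hi).trans (hee i (hi.trans_le s.hL)), fun i _ => ?_,
    hcom, lt_min (half_pos s.pos) (half_pos hz)⟩, hll, hee, hsub, fun y hy => ?_, fun y hy => ?_,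
    ⟨|x' - z| / 2, half_pos hz, fun y hy => ?_⟩, fun i hi => ?_,
    fun y hy => hsmall y (Finset.mem_of_mem_erase hy)⟩
  · obtain ⟨y, hy, hyi⟩ := henum.hits i
    by_cases h : y = x'
    · exact Or.inr (h ▸ hyi)
    · exact Or.inl ⟨y, Finset.mem_erase.2 ⟨h, hy⟩, hyi⟩
  · have hρ := s.pos
    have hy' := Finset.mem_of_mem_erase hy
    simp only [Finset.mem_insert] at hy'
    rcases hy' with rfl | rfl | h
    · right; linarith
    · right; linarith
    · exact Or.inl h
  · have h1 := lt_of_lt_of_le hy (min_le_left _ _)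
    have := abs_sub_le y x' s.x
    linarith
  · have h1 := lt_of_lt_of_le hy (min_le_right _ _)
    have := abs_sub_le x' y z
    rw [abs_sub_comm x' y] at this
    linarith
  · rcases s.hits i hi with ⟨y, hy, hyi⟩ | hx
    · exact ⟨y, hsub hy, hyi⟩
    · exact ⟨b, hbF, hδe i hi hx b hb⟩

/-- The centres of the first `L` balls give a finite set compatible with the prefix; the point `0`
keeps it nonempty when `L = 0`. -/
theorem Stage.exists_initial {Res : Baire → ℚ → Prop} (hcont : ContinuousSelection Res)
    {e₀ : Baire} {L : ℕ} (hres : ∀ e A, (∀ i < L, e₀ i = e i) → Enumerates e A →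
      SeparatesPoints A → A.Nonempty → ∃ y ∈ A, Res e y) : Nonempty (Stage Res e₀ L) := by
  obtain ⟨e', l', x', hee, hll, henum, -, -, hcom, -⟩ := exists_commit hcont hres 0 le_rfl
    (fun _ _ => rfl) (F := insert 0 ((Finset.range L).image fun i => ratNum (e₀ i).unpair.1))
    ⟨0, by simp⟩ (fun i hi => ⟨_, Finset.mem_insert_of_mem
      (Finset.mem_image_of_mem _ (Finset.mem_range.2 hi)), center_mem_codedBall _⟩)
  refine ⟨⟨e', l', x', _, 1, hll.le, hee, fun i _ => ?_, hcom, one_pos⟩⟩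
  obtain ⟨y, hy, hyi⟩ := henum.hits i
  by_cases h : y = x'
  · exact Or.inr (h ▸ hyi)
  · exact Or.inl ⟨y, Finset.mem_erase.2 ⟨h, hy⟩, hyi⟩

/-- There is no continuous overt choice on the rationals, not even on the enumerations with a
given prefix. -/
theorem not_exists_continuousSelection {Res : Baire → ℚ → Prop} (hcont : ContinuousSelection Res)
    (e₀ : Baire) (L : ℕ) : ¬ ∀ e A, (∀ i < L, e₀ i = e i) → Enumerates e A →
      SeparatesPoints A → A.Nonempty → ∃ y ∈ A, Res e y := by
  intro hres
  obtain ⟨s₀⟩ := Stage.exists_initial hcont hres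
  obtain ⟨s, -, hs⟩ := exists_sequence (R := fun n (s t : Stage Res e₀ L) =>
    s.Step t (ratNum n) n) s₀ fun n s => s.exists_step hcont hres (ratNum n) n
  obtain ⟨e, he⟩ := exists_limit (fun n => (s n).e) (fun n => (s n).l) (fun n => (hs n).lt)
    fun n => (hs n).agree
  have hl : StrictMono fun n => (s n).l := strictMono_nat_of_lt_succ fun n => (hs n).lt
  have hS : Monotone fun n => (s n).S := monotone_nat_of_le_succ fun n => (hs n).subset
  have hnear : ∀ d n, (∀ y, |y - (s (n + d)).x| < (s (n + d)).ρ → |y - (s n).x| < (s n).ρ) ∧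
      ∀ y ∈ (s (n + d)).S, y ∈ (s n).S ∨ |y - (s n).x| < (s n).ρ := by
    intro d n
    induction d with
    | zero => exact ⟨fun _ h => h, fun _ h => Or.inl h⟩
    | succ d ih =>
      refine ⟨fun y hy => ih.1 y ((hs (n + d)).nested y hy), fun y hy => ?_⟩
      rcases (hs (n + d)).near y hy with h | h
      · exact ih.2 y h
      · exact Or.inr (ih.1 y h)
  let A : Set ℚ := {y | ∃ n, y ∈ (s n).S}
  have henum : Enumerates e A := by
    refine ⟨fun i => ?_, fun x ⟨n, hn⟩ j => ?_⟩
    · have hi : i < (s (i + 1)).l := (Nat.lt_succ_self i).trans_le hl.le_apply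
      obtain ⟨y, hy, hyi⟩ := (hs (i + 1)).hits i hi
      exact ⟨y, ⟨_, hy⟩, he _ i hi ▸ hyi⟩
    · obtain ⟨i, hi, h⟩ := (hs (max n j)).small x
        (hS ((le_max_left n j).trans (Nat.le_succ _)) hn)
      refine ⟨i, fun y hy => (h y ?_).trans_le
        (pow_le_pow_of_le_one (by norm_num) (by norm_num) (le_max_right n j))⟩
      rwa [he _ i hi]
  -- Step `n` handles the rational `ratNum n`: points settled later remain in a ball away from it,
  -- and only finitely many were settled before.
  have hcl : SeparatesPoints A := by
    intro z hz
    obtain ⟨n, rfl⟩ := ratNum_surjective z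
    obtain ⟨ε, hε, h1⟩ := (hs n).avoid
    obtain ⟨ε', hε', h2⟩ := separatesPoints_finset (s (n + 1)).S (ratNum n) fun h => hz ⟨_, h⟩
    refine ⟨min ε ε', lt_min hε hε', fun y ⟨m, hm⟩ => ?_⟩
    rcases (hnear m (n + 1)).2 y (hS (Nat.le_add_left m (n + 1)) hm) with h | h
    · exact (min_le_right _ _).trans (h2 y h)
    · exact (min_le_left _ _).trans (h1 y h)
  have hne : A.Nonempty := by
    obtain ⟨y, hy, -⟩ := (hs 1).hits 0 ((Nat.zero_le _).trans_lt (hs 0).lt)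
    exact ⟨y, _, hy⟩
  obtain ⟨y, ⟨n, hn⟩, hy⟩ := hres e A (fun i hi => ((s 0).agree i hi).trans
    (he 0 i (hi.trans_le (s 0).hL))) henum hcl hne
  exact (s n).commit e y (he n) hy hn

/-! ### Overt choice on `ℚ` does not reduce to `C_ℕ` -/

theorem names_nat_iff {p : Baire} {n : ℕ} : Names p n ↔ p 0 = n := Iff.rfl

theorem pairing_congr {p p' s s' : Baire} {k : ℕ} (hp : ∀ i < k, p i = p' i)
    (hs : ∀ i < k, s i = s' i) : ∀ i < k, pairing p s i = pairing p' s' i := by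
  intro i hi
  have h2 : i / 2 < k := (Nat.div_le_self i 2).trans_lt hi
  simp only [pairing, hp _ h2, hs _ h2]

theorem Applies.exists_of_names {h : Baire} {B : ClosedSets ℕ} (hB : Names h B) (n : ℕ) :
    ∃ q, Applies h (fun _ => n) q ∧ (n ∉ B.1 ↔ ∃ m, q m ≠ 0) := by
  obtain ⟨U, hU, hn⟩ := hB
  obtain ⟨q, hq, hqn⟩ := hn (fun _ => n) n rfl
  refine ⟨q, hq, Iff.trans ?_ hqn⟩
  rw [← Set.mem_compl_iff, ← hU]
  rfl

theorem not_weihrauchLE_closedChoice_nat :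
    ¬ WeihrauchLE (overtChoice ℚ) (closedChoice ℕ) := by
  intro hle
  obtain ⟨αH, αK, hred⟩ := hle.exists_reduces
  let Ans : Baire → ℕ → Prop := fun e n =>
    ∃ (h : Baire) (B : ClosedSets ℕ), Applies αH (overtName e) h ∧ Names h B ∧ n ∈ B.1
  have hex : ∀ e A, Enumerates e A → SeparatesPoints A → A.Nonempty → ∃ n, Ans e n := by
    intro e A he hA hne
    obtain ⟨h, B, hh, hB, ⟨n, hn⟩, -⟩ :=
      hred (overtName e) ⟨A, hA.isClosedSet⟩ (Enumerates.names he) hne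
    exact ⟨n, h, B, hh, hB, hn⟩
  obtain ⟨n, e₀, L, hn⟩ := exists_uniform_guess (Ans := Ans)
    (fun e he => hex e _ he (fun z hz => absurd trivial hz) ⟨0, trivial⟩) (by
      intro e A he hA hne n hn
      obtain ⟨h, B, hh, hB, -⟩ :=
        hred (overtName e) ⟨A, hA.isClosedSet⟩ (Enumerates.names he) hne
      obtain ⟨q, hq, hqn⟩ := Applies.exists_of_names hB n
      -- Exclusion of `n` shows in one output symbol; its modulus is traced back through `h` and
      -- `overtName` to a prefix of `e`.
      obtain ⟨m, hm⟩ := hqn.1 fun hnB => hn ⟨h, B, hh, hB, hnB⟩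
      obtain ⟨k₁, hk₁⟩ := hq.exists_modulus m
      obtain ⟨k₂, hk₂⟩ := hh.exists_modulus_lt k₁
      refine ⟨k₂, fun e' he' ⟨h', B', hh', hB', hnB'⟩ => ?_⟩
      obtain ⟨q', hq', hqn'⟩ := Applies.exists_of_names hB' n
      refine hqn'.2 ⟨m, ?_⟩ hnB'
      rw [hk₁ h' _ q' (hk₂ _ _ (overtName_congr he') hh') (fun _ _ => rfl) hq']
      exact hm)
  let Res : Baire → ℚ → Prop := fun e y =>
    ∃ r, Applies αK (pairing (overtName e) fun _ => n) r ∧ Names r y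
  have hcont : ContinuousSelection Res := by
    rintro e y ⟨r, hr, hry⟩ ε hε
    obtain ⟨i, hi⟩ := exists_half_pow_lt (half_pos hε)
    obtain ⟨k, hk⟩ := hr.exists_modulus i
    refine ⟨k, fun e' y' he' ⟨r', hr', hry'⟩ => ?_⟩
    have h1 := hk αK _ r' (fun _ _ => rfl)
      (pairing_congr (overtName_congr he') fun _ _ => rfl) hr'
    have h2 := names_rat_iff.1 hry i
    have h3 := names_rat_iff.1 hry' i
    rw [h1, abs_sub_comm] at h3
    have := abs_sub_le y' (ratNum (r i)) y
    linarith
  refine not_exists_continuousSelection hcont e₀ L fun e A hag he hA hne => ?_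
  obtain ⟨h', B', hh', hB', hnB'⟩ := hn e A hag he hA hne
  obtain ⟨h, B, hh, hB, -, hK⟩ :=
    hred (overtName e) ⟨A, hA.isClosedSet⟩ (Enumerates.names he) hne
  obtain rfl := hh.unique hh'
  obtain rfl := RepresentedSpace.unique hB hB'
  obtain ⟨r, hr, y, hy, hry⟩ := hK n hnB' (fun _ => n) rfl
  exact ⟨y, hy, r, hr, hry⟩

/-! ### `C_ℕ` does not reduce to overt choice on `ℚ` -/

/-- A name of the empty open set of natural numbers. -/
theorem tracks_stagewise_empty : Tracks (stagewise fun _ => False) fun _ : ℕ => False := by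
  intro p m _
  obtain ⟨q, hq, hG⟩ := applies_stagewise (fun _ => False) p
  exact ⟨q, hq, fun h => h.elim, fun ⟨i, hi⟩ => (hG i).1 hi⟩

/-- Names of the open set `{n}` that give no information on arguments below `k`. -/
theorem tracks_stagewise_singleton (n k : ℕ) :
    Tracks (stagewise fun w => k ≤ w.length ∧ w[0]? = some n) fun m : ℕ => m = n := by
  intro p m hp
  obtain ⟨q, hq, hG⟩ := applies_stagewise (fun w => k ≤ w.length ∧ w[0]? = some n) p
  refine ⟨q, hq, fun h => ⟨k + 1, (hG _).2 ⟨?_, ?_⟩⟩, fun ⟨i, hi⟩ => ?_⟩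
  · rw [length_prefixOf]; exact Nat.le_succ k
  · rw [getElem?_prefixOf]
    exact ⟨Nat.succ_pos k, (names_nat_iff.1 hp).trans h⟩
  · have := ((hG i).1 hi).2
    rw [getElem?_prefixOf] at this
    exact (names_nat_iff.1 hp).symm.trans this.2

theorem not_weihrauchLE_overtChoice_rat :
    ¬ WeihrauchLE (closedChoice ℕ) (overtChoice ℚ) := by
  intro hle
  obtain ⟨αH, αK, hred⟩ := hle.exists_reduces
  let U₀ : OpenSets ℕ := ⟨fun _ => False, _, tracks_stagewise_empty⟩
  have hU₀ : U₀.toSet = Set.univᶜ := by rw [Set.compl_univ]; rfl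
  obtain ⟨h₀, A₀, hh₀, hA₀, ⟨x, hx⟩, hK₀⟩ := hred (stagewise fun _ => False)
    (⟨Set.univ, U₀, hU₀⟩ : ClosedSets ℕ) ⟨U₀, hU₀, tracks_stagewise_empty⟩ ⟨0, trivial⟩
  obtain ⟨m, rfl⟩ := ratNum_surjective x
  obtain ⟨r, hr, -⟩ := hK₀ _ hx _ (names_const_rat m)
  obtain ⟨k₁, hk₁⟩ := hr.exists_modulus 0
  obtain ⟨O, hO⟩ := exists_openSets (O := {y : ℚ | |y - ratNum m| < (1 / 2) ^ k₁}) (by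
    intro y hy
    refine ⟨(1 / 2) ^ k₁ - |y - ratNum m|, sub_pos.2 hy, fun z hz => ?_⟩
    have := abs_sub_le z y (ratNum m)
    show |z - ratNum m| < _
    linarith)
  obtain ⟨o, ho⟩ := RepresentedSpace.surj O
  obtain ⟨q, hq, hqO⟩ := hA₀ o O ho
  have hhit : Hits A₀.1 O := ⟨ratNum m, by rw [hO]; simp, hx⟩
  obtain ⟨j, hj⟩ := hqO.1 hhit
  obtain ⟨k₂, hk₂⟩ := hq.exists_modulus j
  obtain ⟨k₃, hk₃⟩ := hh₀.exists_modulus_lt k₂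
  set k := max k₁ k₃ with hk
  let U₁ : OpenSets ℕ := ⟨fun i => i = r 0, _, tracks_stagewise_singleton (r 0) k⟩
  have hU₁ : U₁.toSet = ({r 0}ᶜ)ᶜ := by rw [compl_compl]; rfl
  obtain ⟨h₁, A₁, hh₁, hA₁, -, hK₁⟩ := hred
    (stagewise fun w => k ≤ w.length ∧ w[0]? = some (r 0)) (⟨{r 0}ᶜ, U₁, hU₁⟩ : ClosedSets ℕ)
    ⟨U₁, hU₁, tracks_stagewise_singleton (r 0) k⟩ ⟨r 0 + 1, Nat.succ_ne_self (r 0)⟩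
  have hagree : ∀ c < k, stagewise (fun _ => False) c =
      stagewise (fun w => k ≤ w.length ∧ w[0]? = some (r 0)) c := fun c hc =>
    stagewise_congr fun w hw => ⟨False.elim, fun h => absurd h.1 (by omega)⟩
  obtain ⟨q', hq', hqO'⟩ := hA₁ o O ho
  -- The old overt name had already reported a hit of `O` within the part shared with the new one.
  -- Hence `A₁` has a point in the ball, and that point has a name on which the output is still `r
  -- 0`, now forbidden.
  have hhit' : Hits A₁.1 O := hqO'.2 ⟨j, by
    rw [hk₂ h₁ o q' (hk₃ _ _ (fun c hc => hagree c (lt_max_of_lt_right hc)) hh₁)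
      (fun _ _ => rfl) hq']
    exact hj⟩
  obtain ⟨y, hyO, hyA⟩ := hhit'
  rw [hO] at hyO
  obtain ⟨s, hs, hms⟩ := exists_names_of_close hyO
  obtain ⟨r', hr', z, hz, hrz⟩ := hK₁ y hyA s hs
  refine hz ?_
  rw [Set.mem_singleton_iff, ← names_nat_iff.1 hrz]
  exact hk₁ αK _ r' (fun _ _ => rfl)
    (pairing_congr (fun c hc => hagree c (lt_max_of_lt_left hc)) hms) hr'

/-! ### `C_ℚ` reduces to `C_ℕ` -/

/-- The word occurring in a query. -/
def queryWord (N : ℕ) : List ℕ := (Encodable.decode N.unpair.2 : Option (List ℕ)).getD []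

theorem queryWord_query (s : Baire) (i k : ℕ) : queryWord (query s i k) = prefixOf s k := by
  simp [queryWord, query]

theorem unpair_query (s : Baire) (i k : ℕ) : (query s i k).unpair.1 = i := by simp [query]

theorem getD_prefixOf (s : Baire) {i k : ℕ} (h : i < k) : (prefixOf s k).getD i 0 = s i := by
  simp [prefixOf, h]

theorem primrec_queryWord : Primrec queryWord :=
  Primrec.option_getD.comp (Primrec.decode.comp (Primrec.snd.comp Primrec.unpair))
    (Primrec.const [])

theorem primrec_queryIndex : Primrec fun N : ℕ => N.unpair.1 := Primrec.fst.comp Primrec.unpair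

theorem primrec_queryLength : Primrec fun N => (queryWord N).length :=
  Primrec.list_length.comp primrec_queryWord

theorem primrec_getD {f : ℕ → List ℕ} {i : ℕ → ℕ} (hf : Primrec f) (hi : Primrec i) :
    Primrec fun N => (f N).getD (i N) 0 :=
  (Primrec.list_getD 0).comp hf hi

theorem primrec_query_const {i m k : ℕ → ℕ} (hi : Primrec i) (hm : Primrec m) (hk : Primrec k) :
    Primrec fun N => query (fun _ => m N) (i N) (k N) :=
  Primrec₂.natPair.comp hi (Primrec.encode.comp
    (Primrec.list_map (Primrec.list_range.comp hk) (hm.comp Primrec.fst).to₂))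

theorem closedChoice_rat_weihrauchLE : WeihrauchLE (closedChoice ℚ) (closedChoice ℕ) := by
  obtain ⟨αH, hαH, hH⟩ := exists_computable_applies
    -- One input symbol is spent on reading the natural number `m`; afterwards `p` is simulated on
    -- the constant name of `ratNum m`, with prefixes one shorter.
    (φ := fun N => query (fun _ => (queryWord N).getD 0 0) N.unpair.1 ((queryWord N).length - 1))
    (g := fun N a => if (queryWord N).length = 0 then 0 else a)
    (primrec_query_const primrec_queryIndex (primrec_getD primrec_queryWord (Primrec.const 0))
      (Primrec.nat_sub.comp primrec_queryLength (Primrec.const 1))).to_comp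
    (Primrec.ite (Primrec.eq.comp (primrec_queryLength.comp Primrec.fst) (Primrec.const 0))
      (Primrec.const 0) Primrec.snd).to_comp
  -- Position `1` of `pairing p s` holds `s 0`.
  obtain ⟨αK, hαK, hK⟩ := exists_computable_applies (φ := fun _ => 1) (g := fun _ a => a)
    (Computable.const 1) Computable.snd
  refine Reduces.weihrauchLE (αH := αH) (αK := αK) (fun p A hp hA => ?_) hαH hαK
  obtain ⟨U, hU, hpU⟩ := hp
  have hmem : ∀ x, x ∈ A.1 ↔ ¬ U.1 x := fun x => by
    rw [← Set.notMem_compl_iff, ← hU]; rfl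
  let h : Baire := fun N => if (queryWord N).length = 0 then 0 else
    p (query (fun _ => (queryWord N).getD 0 0) N.unpair.1 ((queryWord N).length - 1))
  have hq : ∀ (s : Baire) i k, h (query s i k) = if k = 0 then 0 else
      p (query (fun _ => s 0) i (k - 1)) := by
    intro s i k
    by_cases hk : k = 0
    · simp only [h, queryWord_query, length_prefixOf, hk, if_true]
    · simp only [h, queryWord_query, length_prefixOf, hk, unpair_query, if_false,
        getD_prefixOf s (Nat.pos_of_ne_zero hk)]
  have htr : Tracks h fun m : ℕ => U.1 (ratNum m) := by
    intro s m hs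
    obtain ⟨q, hqa, hqU⟩ := hpU _ _ (names_const_rat m)
    refine ⟨q, fun i => ?_, hqU⟩
    obtain ⟨k, hk, hk0⟩ := hqa i
    rw [names_nat_iff] at hs
    refine ⟨k + 1, ?_, fun j hj => ?_⟩
    · refine (hq s i (k + 1)).trans ?_
      rw [if_neg (Nat.succ_ne_zero k), Nat.add_sub_cancel, hs]
      exact hk
    · refine (hq s i j).trans ?_
      by_cases hj0 : j = 0
      · rw [if_pos hj0]
      · rw [if_neg hj0, hs]
        exact hk0 (j - 1) (by omega)
  let V : OpenSets ℕ := ⟨_, h, htr⟩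
  have hV : V.toSet = {m | ratNum m ∈ A.1}ᶜ := by
    ext m
    exact (not_not.symm.trans (not_congr (hmem _).symm) : U.1 (ratNum m) ↔ _)
  obtain ⟨x, hx⟩ := hA
  obtain ⟨m, rfl⟩ := ratNum_surjective x
  refine ⟨h, (⟨{m | ratNum m ∈ A.1}, V, hV⟩ : ClosedSets ℕ), hH p, ⟨V, hV, htr⟩, ⟨m, hx⟩,
    fun v hv s hs => ⟨_, hK _, ratNum v, hv, ?_⟩⟩
  have : pairing p s 1 = v := by
    rw [← names_nat_iff.1 hs]; simp [pairing]
  simp only [this]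
  exact names_const_rat v

/-! ### `C_ℕ` reduces to `C_ℚ` -/

/-- The natural number nearest to the rational with code `m`. -/
def roundCode (m : ℕ) : ℕ :=
  (2 * m.unpair.1.unpair.1 + (m.unpair.2 + 1) - 2 * m.unpair.1.unpair.2) /
    (2 * (m.unpair.2 + 1))

theorem roundCode_eq {m x : ℕ} (h : |ratNum m - x| ≤ 1 / 4) : roundCode m = x := by
  unfold ratNum at h
  unfold roundCode
  generalize m.unpair.1.unpair.1 = a at *
  generalize m.unpair.1.unpair.2 = b at *
  generalize m.unpair.2 = c at *
  have hc : (0 : ℚ) < (c : ℚ) + 1 := by positivity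
  obtain ⟨h1, h2⟩ := abs_le.1 h
  have h3 : ((a : ℚ) - b) / (c + 1) ≤ x + 1 / 4 := by linarith
  have h4 : (x : ℚ) - 1 / 4 ≤ ((a : ℚ) - b) / (c + 1) := by linarith
  rw [div_le_iff₀ hc] at h3
  rw [le_div_iff₀ hc] at h4
  have h5 : 4 * a ≤ 4 * (x * (c + 1)) + (c + 1) + 4 * b := by
    have : (4 * a : ℚ) ≤ 4 * (x * (c + 1)) + (c + 1) + 4 * b := by linarith
    exact_mod_cast this
  have h6 : 4 * (x * (c + 1)) + 4 * b ≤ 4 * a + (c + 1) := by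
    have : (4 * (x * (c + 1)) + 4 * b : ℚ) ≤ 4 * a + (c + 1) := by linarith
    exact_mod_cast this
  apply Nat.div_eq_of_lt_le
  · have : x * (2 * (c + 1)) = 2 * (x * (c + 1)) := by ring
    omega
  · have : (x + 1) * (2 * (c + 1)) = 2 * (x * (c + 1)) + 2 * (c + 1) := by ring
    omega

/-- The rational with code `m` has a distance of more than `1 / (i + 1)` from `n`. -/
def IsFar (n m i : ℕ) : Prop :=
  m.unpair.2 + 1 + (m.unpair.1.unpair.2 + n * (m.unpair.2 + 1)) * (i + 1) <
      m.unpair.1.unpair.1 * (i + 1) ∨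
    m.unpair.2 + 1 + m.unpair.1.unpair.1 * (i + 1) <
      (m.unpair.1.unpair.2 + n * (m.unpair.2 + 1)) * (i + 1)

instance (n m i : ℕ) : Decidable (IsFar n m i) := by unfold IsFar; infer_instance

theorem isFar_iff {n m i : ℕ} : IsFar n m i ↔ 1 / ((i : ℚ) + 1) < |ratNum m - n| := by
  unfold ratNum IsFar
  generalize m.unpair.1.unpair.1 = a
  generalize m.unpair.1.unpair.2 = b
  generalize m.unpair.2 = c
  have hc : (0 : ℚ) < (c : ℚ) + 1 := by positivity
  have hi : (0 : ℚ) < (i : ℚ) + 1 := by positivity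
  have key : ((a : ℚ) - b) / (c + 1) - n = (a - b - n * (c + 1)) / (c + 1) := by
    field_simp
  rw [lt_abs, key, ← neg_div, div_lt_div_iff₀ hi hc, div_lt_div_iff₀ hi hc,
    ← Nat.cast_lt (α := ℚ), ← Nat.cast_lt (α := ℚ)]
  push_cast
  constructor <;> (rintro (h | h) <;> [left; right] <;> linarith)

theorem primrec_roundCode : Primrec roundCode := by
  have hc : Primrec fun m : ℕ => m.unpair.2 + 1 :=
    Primrec.succ.comp (Primrec.snd.comp Primrec.unpair)
  have hab : Primrec fun m : ℕ => m.unpair.1.unpair :=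
    Primrec.unpair.comp (Primrec.fst.comp Primrec.unpair)
  have h2 : Primrec fun _ : ℕ => 2 := Primrec.const 2
  exact Primrec.nat_div.comp
    (Primrec.nat_sub.comp
      (Primrec.nat_add.comp (Primrec.nat_mul.comp h2 (Primrec.fst.comp hab)) hc)
      (Primrec.nat_mul.comp h2 (Primrec.snd.comp hab)))
    (Primrec.nat_mul.comp h2 hc)

theorem primrecPred_isFar {α : Type*} [Primcodable α] {n m i : α → ℕ} (hn : Primrec n)
    (hm : Primrec m) (hi : Primrec i) : PrimrecPred fun x => IsFar (n x) (m x) (i x) := by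
  have hc : Primrec fun x => (m x).unpair.2 + 1 :=
    Primrec.succ.comp (Primrec.snd.comp (Primrec.unpair.comp hm))
  have hab : Primrec fun x => (m x).unpair.1.unpair :=
    Primrec.unpair.comp (Primrec.fst.comp (Primrec.unpair.comp hm))
  have hi' : Primrec fun x => i x + 1 := Primrec.succ.comp hi
  have h1 := Primrec.nat_mul.comp (Primrec.fst.comp hab) hi'
  have h2 := Primrec.nat_mul.comp
    (Primrec.nat_add.comp (Primrec.snd.comp hab) (Primrec.nat_mul.comp hn hc)) hi'
  exact (Primrec.nat_lt.comp (Primrec.nat_add.comp hc h2) h1).or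
    (Primrec.nat_lt.comp (Primrec.nat_add.comp hc h1) h2)

/-- The threshold of `IsFar` dominates the Cauchy error, so a positive test is always sound. -/
theorem half_pow_le_inv (i : ℕ) : (1 / 2 : ℚ) ^ i ≤ 1 / ((i : ℚ) + 1) := by
  rw [one_div_pow]
  apply one_div_le_one_div_of_le (by positivity)
  exact_mod_cast Nat.lt_two_pow_self (n := i)

theorem roundCode_of_names {s : Baire} {n : ℕ} (hs : Names s (n : ℚ)) : roundCode (s 2) = n := by
  apply roundCode_eq
  have := names_rat_iff.1 hs 2
  norm_num at this ⊢
  exact this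

/-- Along a name of `x`, the test detects whether `x` differs from `n`. -/
theorem exists_isFar_iff {s : Baire} {x : ℚ} (hs : Names s x) (n : ℕ) :
    (∃ i, IsFar n (s i) i) ↔ x ≠ n := by
  constructor
  · rintro ⟨i, hi⟩ rfl
    exact (isFar_iff.1 hi).not_ge ((names_rat_iff.1 hs i).trans (half_pow_le_inv i))
  · intro hx
    have hpos : 0 < |x - n| := abs_pos.2 (sub_ne_zero.2 hx)
    obtain ⟨i, hi⟩ := exists_nat_one_div_lt (half_pos hpos)
    refine ⟨i, isFar_iff.2 ?_⟩
    have h1 := (names_rat_iff.1 hs i).trans (half_pow_le_inv i)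
    have h2 := abs_sub_le x (ratNum (s i)) n
    rw [abs_sub_comm x (ratNum (s i))] at h2
    linarith

/-- Given a name `s` of `x`, only `n = roundCode (s 2)` can equal `x` among the naturals. So `x`
lies outside the embedded `A` iff `x ≠ n` or `n ∉ A`. Even output symbols test the first
alternative, odd ones simulate the given name on `n`. -/
theorem closedChoice_nat_weihrauchLE : WeihrauchLE (closedChoice ℕ) (closedChoice ℚ) := by
  have hr : Primrec fun N => roundCode ((queryWord N).getD 2 0) :=
    primrec_roundCode.comp (primrec_getD primrec_queryWord (Primrec.const 2))
  have hi : Primrec fun N : ℕ => N.unpair.1 / 2 :=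
    Primrec.nat_div.comp primrec_queryIndex (Primrec.const 2)
  have hd : Primrec fun N : ℕ => N.unpair.1 / 2 + 3 :=
    Primrec.nat_add.comp hi (Primrec.const 3)
  obtain ⟨αH, hαH, hH⟩ := exists_computable_applies
    -- Waiting for `i / 2 + 3` input symbols makes both `s 2` and `s (i / 2)` available.
    (φ := fun N => query (fun _ => roundCode ((queryWord N).getD 2 0)) (N.unpair.1 / 2)
      ((queryWord N).length - (N.unpair.1 / 2 + 3)))
    (g := fun N a => if (queryWord N).length < N.unpair.1 / 2 + 3 then 0 else
      if N.unpair.1 % 2 = 0 then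
        if IsFar (roundCode ((queryWord N).getD 2 0)) ((queryWord N).getD (N.unpair.1 / 2) 0)
          (N.unpair.1 / 2) then 2 else 1
      else a)
    (primrec_query_const hi hr (Primrec.nat_sub.comp primrec_queryLength hd)).to_comp
    (Primrec.ite (Primrec.nat_lt.comp (primrec_queryLength.comp Primrec.fst)
        (hd.comp Primrec.fst)) (Primrec.const 0)
      (Primrec.ite (Primrec.eq.comp (Primrec.nat_mod.comp (primrec_queryIndex.comp Primrec.fst)
          (Primrec.const 2)) (Primrec.const 0))
        (Primrec.ite (primrecPred_isFar (hr.comp Primrec.fst)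
          ((primrec_getD primrec_queryWord hi).comp Primrec.fst) (hi.comp Primrec.fst))
          (Primrec.const 2) (Primrec.const 1))
        Primrec.snd)).to_comp
  -- Position `5` of `pairing p s` holds `s 2`, whose error is at most `1 / 4`.
  obtain ⟨αK, hαK, hK⟩ := exists_computable_applies (φ := fun _ => 5) (g := fun _ a => roundCode a)
    (Computable.const 5) (primrec_roundCode.to_comp.comp Computable.snd)
  refine Reduces.weihrauchLE (αH := αH) (αK := αK) (fun p A hp hA => ?_) hαH hαK
  obtain ⟨U, hU, hpU⟩ := hp
  have hmem : ∀ x, x ∈ A.1 ↔ ¬ U.1 x := fun x => by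
    rw [← Set.notMem_compl_iff, ← hU]; rfl
  obtain ⟨h, hh, hHp⟩ : ∃ h : Baire, (∀ (s : Baire) i k, h (query s i k) =
      if k < i / 2 + 3 then 0 else
        if i % 2 = 0 then if IsFar (roundCode (s 2)) (s (i / 2)) (i / 2) then 2 else 1
        else p (query (fun _ => roundCode (s 2)) (i / 2) (k - (i / 2 + 3)))) ∧ Applies αH p h := by
    refine ⟨_, fun s i k => ?_, hH p⟩
    by_cases hk : k < i / 2 + 3
    · simp only [queryWord_query, length_prefixOf, unpair_query, hk, if_true]
    · simp only [queryWord_query, length_prefixOf, unpair_query, hk, if_false,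
        getD_prefixOf s (show 2 < k by omega), getD_prefixOf s (show i / 2 < k by omega)]
  have htr : Tracks h fun x : ℚ => ∀ n : ℕ, x = n → U.1 n := by
    intro s x hs
    obtain ⟨q, hqa, hqU⟩ := hpU (fun _ => roundCode (s 2)) _ rfl
    refine ⟨fun i => if i % 2 = 0 then if IsFar (roundCode (s 2)) (s (i / 2)) (i / 2) then 1 else 0
      else q (i / 2), fun i => ?_, ?_⟩
    · by_cases hi2 : i % 2 = 0
      · refine ⟨i / 2 + 3, (hh s i _).trans ?_, fun j hj => (hh s i j).trans (if_pos hj)⟩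
        simp only [lt_irrefl, if_false, hi2, if_true]
        split_ifs <;> rfl
      · obtain ⟨k, hk, hk0⟩ := hqa (i / 2)
        refine ⟨k + (i / 2 + 3), (hh s i _).trans ?_, fun j hj => (hh s i j).trans ?_⟩
        · simp only [hi2, if_false, Nat.add_sub_cancel]
          rw [if_neg (by omega)]
          exact hk
        · by_cases hj' : j < i / 2 + 3
          · rw [if_pos hj']
          · rw [if_neg hj', if_neg hi2]
            exact hk0 _ (by omega)
    · have hfar := exists_isFar_iff hs (roundCode (s 2))
      have hU' : (∀ n : ℕ, x = n → U.1 n) ↔ x ≠ roundCode (s 2) ∨ U.1 (roundCode (s 2)) := by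
        constructor
        · intro hx
          by_cases hxn : x = roundCode (s 2)
          · exact Or.inr (hx _ hxn)
          · exact Or.inl hxn
        · rintro hx n rfl
          rw [roundCode_of_names hs] at hx
          exact hx.resolve_left (not_not.2 rfl)
      refine hU'.trans ((or_congr hfar.symm hqU).trans ⟨?_, ?_⟩)
      · rintro (⟨i, hi⟩ | ⟨i, hi⟩)
        · refine ⟨2 * i, ?_⟩
          have h1 : 2 * i % 2 = 0 := by omega
          have h2 : 2 * i / 2 = i := by omega
          simp [hi]
        · refine ⟨2 * i + 1, ?_⟩
          have h1 : ¬ (2 * i + 1) % 2 = 0 := by omega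
          have h2 : (2 * i + 1) / 2 = i := by omega
          simp only [h1, h2, if_false]
          exact hi
      · rintro ⟨i, hi⟩
        by_cases hi2 : i % 2 = 0
        · left
          refine ⟨i / 2, by_contra fun hf => hi ?_⟩
          simp only [hi2, if_true, hf, if_false]
        · right
          simp only [hi2, if_false] at hi
          exact ⟨_, hi⟩
  let V : OpenSets ℚ := ⟨_, h, htr⟩
  have hV : V.toSet = {x | ∃ n ∈ A.1, x = ((n : ℕ) : ℚ)}ᶜ := by
    ext x
    refine (?_ : (∀ n : ℕ, x = n → U.1 n) ↔ ¬ ∃ n ∈ A.1, x = ((n : ℕ) : ℚ))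
    rw [not_exists]
    refine forall_congr' fun n => ?_
    rw [hmem]
    tauto
  obtain ⟨n, hn⟩ := hA
  refine ⟨h, (⟨_, V, hV⟩ : ClosedSets ℚ), hHp, ⟨V, hV, htr⟩, ⟨n, n, hn, rfl⟩, ?_⟩
  rintro v ⟨m, hm, rfl⟩ s hs
  refine ⟨_, hK _, m, hm, ?_⟩
  have : pairing p s 5 = s 2 := by simp [pairing]
  rw [names_nat_iff, this, roundCode_of_names hs]

end OvertChoice

theorem mainTheorem12 :
    OvertChoice.WeihrauchIncomparable (OvertChoice.overtChoice ℚ) (OvertChoice.closedChoice ℕ) ∧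
      OvertChoice.WeihrauchEquiv (OvertChoice.closedChoice ℕ) (OvertChoice.closedChoice ℚ) :=
  ⟨⟨OvertChoice.not_weihrauchLE_closedChoice_nat, OvertChoice.not_weihrauchLE_overtChoice_rat⟩,
    OvertChoice.closedChoice_nat_weihrauchLE, OvertChoice.closedChoice_rat_weihrauchLE⟩
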